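/- A \emph{two-way nondeterministic finite automaton} (2NFA) has a finite input alphabet $\Sigma$, a finite set of states $Q$, a set of initial states $Q_0\subseteq Q$, a transition function $\delta\colon Q\times(\Sigma\cup\{\vdash,\dashv\})\to\mathcal P(Q\times\{-1,+1\})$, where $\vdash,\dashv\notin\Sigma$ are the end-markers, and a set of accepting states $F\subseteq Q$ with $\delta(q,\dashv)=\emptyset$ for all $q\in F$. On an input $w=a_1\cdots a_\ell$, with $a_0=\vdash$ and $a_{\ell+1}=\dashv$, it moves from a configuration $(p,k)$ to $(p',k')$, where $0\le k,k'\le \ell+1$, if $(p',k'-k)\in\delta(p,a_k)$; it accepts $w$ if some configuration $(q,\ell+1)$ with $q\in F$ is reachable from some $(q_0,0)$ with $q_0\in Q_0$. A one-way nondeterministic finite automaton (NFA), possibly with several initial states, is \emph{unambiguous} (a UFA) if every string has at most one accepting computation. Let $n$ be a positive integer and $[n]=\{1,\dots,n\}$. A \emph{prefix table} is a function $f\colon[n]\to\mathcal P([n])\setminus\{\emptyset\}$ such that for some $i$, $f(i)\subseteq f(j)$ for all $j$. A \emph{suffix table} is a function $g\colon[n]\to\mathcal P([n]\cup\{\mathrm{Accept}\})$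 such that $\mathrm{Accept}\in g(i)$ for some $i$, and $g(i)=[n]\cup\{\mathrm{Accept}\}$ whenever $\mathrm{Accept}\in g(i)$. Let $\Gamma_n$ be the finite alphabet consisting of the symbols $(\mathrm L,i)$ for $i\in[n]$, $(\mathrm L,f)$ for prefix tables $f$, and $(\mathrm R,g)$ for suffix tables $g$. Let $\mathcal A_n$ be the $n$-state 2NFA over $\Gamma_n$ with set of states $[n]$, initial state $1$, all states accepting, and transitions $\delta(q,\vdash)=\{(q,+1)\}$, $\delta(q,\dashv)=\emptyset$, $\delta(q,(\mathrm L,i))=\{(i,+1)\}$, $\delta(q,(\mathrm L,f))=f(q)\times\{+1\}$, and $\delta(q,(\mathrm R,g))=\{(q,+1)\}$ if $\mathrm{Accept}\in g(q)$, and $g(q)\times\{-1\}$ otherwise. \textbf{Theorem.} For every positive integer $n$, every UFA that recognizes the language $L_n$ of the $n$-state 2NFA $\mathcal A_n$ has at least $$\sum_{k=1}^{n}(k-1)!\,k!\,S(n,k)\,S(n+1,k)$$ states, where $S(m,k)$ denotes the Stirling numbers of the second kind. In particular, for every $n$ there is a language recognized by a 2NFA with $n$ states such that every UFA for it has at least this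 many states. -/

import Mathlib

/-! ### One-way unambiguous automata -/

namespace NFA

variable {α σ : Type*}

/-- An accepting computation `p 0, p 1, …, p ℓ` of a (one-way) NFA on a string of length `ℓ`. -/
def IsAcceptingRun (M : NFA α σ) (w : List α) (p : Fin (w.length + 1) → σ) : Prop :=
  p 0 ∈ M.start ∧
  (∀ i : Fin w.length, p i.succ ∈ M.step (p i.castSucc) (w.get i)) ∧
  p (Fin.last w.length) ∈ M.accept

/-- An NFA is unambiguous if every string has at most one accepting computation. -/
def IsUnambiguous (M : NFA α σ) : Prop :=
  ∀ (w : List α) (p p' : Fin (w.length + 1) → σ),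
    M.IsAcceptingRun w p → M.IsAcceptingRun w p' → p = p'

end NFA

/-! ### Two-way nondeterministic automata -/

/-- Directions of head moves: `left` is `-1`, `right` is `+1`. -/
inductive HeadMove : Type
  | left
  | right

/-- Tape symbols: the left end-marker, the input symbols and the right end-marker. -/
inductive TapeSymbol (α : Type*) : Type _
  | leftEnd
  | letter (a : α)
  | rightEnd

/-- A two-way nondeterministic automaton with input alphabet `α` and set of states `σ`
(both are finite wherever this structure is used). -/
structure TwoNFA (α σ : Type*) where
  step : σ → TapeSymbol α → Set (σ × HeadMove)
  start : Set σ
  accept : Set σ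
  step_accept : ∀ q ∈ accept, step q TapeSymbol.rightEnd = ∅

namespace TwoNFA

variable {α σ : Type*}

/-- The symbol at position `k` of the tape holding `w = a₁ … a_ℓ` between the end-markers:
the left end-marker at position `0`, the letter `a_k` at position `1 ≤ k ≤ ℓ`,
and the right end-marker at position `ℓ + 1`. (Positions beyond `ℓ + 1` are never visited.) -/
def symbolAt (w : List α) : ℕ → TapeSymbol α
  | 0 => TapeSymbol.leftEnd
  | k + 1 =>
    match w[k]? with
    | some a => TapeSymbol.letter a
    | none => TapeSymbol.rightEnd

/-- One move of the automaton between configurations `(state, head position)` on the input `w`.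
The head stays within the positions `0, …, ℓ + 1`. -/
def Move (A : TwoNFA α σ) (w : List α) (c d : σ × ℕ) : Prop :=
  d.2 ≤ w.length + 1 ∧
  (((d.1, HeadMove.right) ∈ A.step c.1 (symbolAt w c.2) ∧ d.2 = c.2 + 1) ∨
   ((d.1, HeadMove.left) ∈ A.step c.1 (symbolAt w c.2) ∧ d.2 + 1 = c.2))

/-- A string of length `ℓ` is accepted if some computation starting in an initial state at
position `0` reaches an accepting state at position `ℓ + 1`. By `not_move_of_accept` such a
computation cannot be continued, that is, it is automatically a maximal one. -/
def language (A : TwoNFA α σ) : Language α :=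
  {w | ∃ q₀ ∈ A.start, ∃ q ∈ A.accept,
    Relation.ReflTransGen (A.Move w) (q₀, 0) (q, w.length + 1)}

theorem not_move_of_accept (A : TwoNFA α σ) (w : List α) {q : σ} (hq : q ∈ A.accept)
    (d : σ × ℕ) : ¬ A.Move w (q, w.length + 1) d := by
  have h : symbolAt w (w.length + 1) = TapeSymbol.rightEnd := by simp [symbolAt]
  simp [Move, h, A.step_accept q hq]

end TwoNFA

/-! ### The universal two-way automaton; `Fin n` plays the role of `[n] = {1, …, n}` -/

/-- Prefix tables: functions from `[n]` to nonempty subsets of `[n]`, one value of which is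
contained in all the others. -/
def PrefixTable (n : ℕ) : Type :=
  {f : Fin n → Finset (Fin n) // (∀ i, (f i).Nonempty) ∧ ∃ i, ∀ j, f i ⊆ f j}

/-- Suffix tables: functions from `[n]` to subsets of `[n] ∪ {Accept}`, where `none` stands for
`Accept`; some value contains `Accept`, and each value that contains it is the whole set. -/
def SuffixTable (n : ℕ) : Type :=
  {g : Fin n → Finset (Option (Fin n)) //
    (∃ i, none ∈ g i) ∧ ∀ i, none ∈ g i → g i = Finset.univ}

/-- The alphabet `Γ_n`. -/
inductive UniversalAlphabet (n : ℕ) : Type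
  | leftState (i : Fin n)
  | leftTable (f : PrefixTable n)
  | rightTable (g : SuffixTable n)

instance (n : ℕ) : Finite (PrefixTable n) := by
  unfold PrefixTable
  infer_instance

instance (n : ℕ) : Finite (SuffixTable n) := by
  unfold SuffixTable
  infer_instance

instance (n : ℕ) : Finite (UniversalAlphabet n) := by
  refine Finite.of_surjective
    (fun x : Fin n ⊕ PrefixTable n ⊕ SuffixTable n =>
      Sum.elim UniversalAlphabet.leftState
        (Sum.elim UniversalAlphabet.leftTable UniversalAlphabet.rightTable) x) ?_
  rintro (i | f | g)
  · exact ⟨Sum.inl i, rfl⟩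
  · exact ⟨Sum.inr (Sum.inl f), rfl⟩
  · exact ⟨Sum.inr (Sum.inr g), rfl⟩

/-- The transition function of the universal automaton. At the left end-marker it moves right
without changing its state, at the right end-marker it has no transitions. -/
def universalStep (n : ℕ) (q : Fin n) :
    TapeSymbol (UniversalAlphabet n) → Set (Fin n × HeadMove)
  | .leftEnd => {(q, HeadMove.right)}
  | .letter (.leftState i) => {(i, HeadMove.right)}
  | .letter (.leftTable f) => {x | x.1 ∈ f.1 q ∧ x.2 = HeadMove.right}
  | .letter (.rightTable g) =>
      if none ∈ g.1 q then {(q, HeadMove.right)}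
      else {x | some x.1 ∈ g.1 q ∧ x.2 = HeadMove.left}
  | .rightEnd => ∅

/-- The universal automaton `A_n`: its states are `[n]`, the initial state is the first one,
and all states are accepting. -/
def universalTwoNFA (n : ℕ) : TwoNFA (UniversalAlphabet n) (Fin n) where
  step := universalStep n
  start := {q | (q : ℕ) = 0}
  accept := Set.univ
  step_accept := fun _ _ => rfl

/-! By unambiguity the matrix with entries `[u ++ v ∈ L]` factors through the states of a UFA, so
its rank over any field bounds their number from below (`IsUnambiguous.card_le_card_states`). It
remains to find enough independent rows over `ZMod 2`.

The rows are words `(L,i)(L,f)`, where `f x = {q | b q ≤ a x}` runs through a chain of `k` distinct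
nonempty sets and `a i = 0`. With `u k = k! S(n,k)` there are `u k * (u k + u (k+1))` such chains:
`a` is onto the `k` levels, and `b` may also take a top level that lies in no set. Summing over `k`,
shifting one index and using `u (k-1) + u k = (k-1)! S(n+1,k)` gives the stated bound.

The columns are suffix tables given by levels too, and acceptance means climbing past each level in
turn (`mem_language_iff_climbsLevels`). For a fixed chain, the columns obtained by independently
raising arbitrary sets of states within each level are added up. The climbing conditions at
different levels involve disjoint choices, so the sum is a product over levels
(`sum_climbsLevels_eq_prod`), and parity turns "some state is entered" into "all are".

Evaluated at another chain, this product is 1 on the diagonal. If it is nonzero, the other chain has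
at least as many levels; if it has equally many, the two chains agree except that states of column
level 0 may rise and states in no set may join one, and then `weight` grows. So the resulting matrix
is triangular. -/

/-! ### Counting surjections -/

/-- Maps that hit every element except possibly `v` are the surjections and the maps onto the
complement of `v`. -/
theorem card_covering_except {α β : Type*} [Finite α] [Finite β] (v : β) :
    Nat.card {f : α → β // ∀ y, y ≠ v → ∃ x, f x = y} =
      Nat.card {f : α → β // f.Surjective} +
        Nat.card {f : α → {y : β // y ≠ v} // f.Surjective} := by
  rw [← Nat.card_sum]
  symm
  refine Nat.card_eq_of_bijective (fun s => Sum.elim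
    (fun f : {f : α → β // f.Surjective} =>
      (⟨f.1, fun y _ => f.2 y⟩ : {f : α → β // ∀ y, y ≠ v → ∃ x, f x = y}))
    (fun f : {f : α → {y : β // y ≠ v} // f.Surjective} => ⟨fun x => (f.1 x).1, fun y hy => by
      obtain ⟨x, hx⟩ := f.2 ⟨y, hy⟩
      exact ⟨x, congrArg Subtype.val hx⟩⟩) s) ⟨?_, ?_⟩
  · rintro (⟨f, hf⟩ | ⟨f, hf⟩) (⟨g, hg⟩ | ⟨g, hg⟩) h
    · simpa using h
    · obtain ⟨x, hx⟩ := hf v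
      exact absurd ((congrFun (congrArg Subtype.val h) x).symm.trans hx) (g x).2
    · obtain ⟨x, hx⟩ := hg v
      exact absurd ((congrFun (congrArg Subtype.val h) x).trans hx) (f x).2
    · have : f = g := funext fun x => Subtype.ext (congrFun (congrArg Subtype.val h) x)
      subst this
      rfl
  · rintro ⟨f, hf⟩
    by_cases hv : ∃ x, f x = v
    · exact ⟨Sum.inl ⟨f, fun y => (eq_or_ne y v).elim (fun h => h ▸ hv) (hf y)⟩, rfl⟩
    · push Not at hv
      refine ⟨Sum.inr ⟨fun x => ⟨f x, hv x⟩, fun y => ?_⟩, rfl⟩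
      obtain ⟨x, hx⟩ := hf y y.2
      exact ⟨x, Subtype.ext hx⟩

/-- Induction on `n`: once the value `v` at `0` is fixed, the tail need only hit everything except
`v`, which by `card_covering_except` reproduces the recurrence of the Stirling numbers. -/
theorem card_surjective_fin (n : ℕ) {β : Type*} [Finite β] :
    Nat.card {f : Fin n → β // f.Surjective} =
      (Nat.card β).factorial * Nat.stirlingSecond n (Nat.card β) := by
  induction n generalizing β with
  | zero =>
    rcases isEmpty_or_nonempty β with hβ | hβ
    · have : Unique {f : Fin 0 → β // f.Surjective} :=
        ⟨⟨⟨Fin.elim0, fun y => hβ.elim y⟩⟩, fun f => Subtype.ext (funext fun x => x.elim0)⟩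
      simp
    · have : IsEmpty {f : Fin 0 → β // f.Surjective} :=
        ⟨fun f => (f.2 hβ.some).elim fun x _ => x.elim0⟩
      obtain ⟨k, hk⟩ := Nat.exists_eq_add_one_of_ne_zero (Nat.card_pos (α := β)).ne'
      simp [hk]
  | succ n ih =>
    have e : {f : Fin (n + 1) → β // f.Surjective} ≃
        (v : β) × {f : Fin n → β // ∀ y, y ≠ v → ∃ x, f x = y} :=
      { toFun := fun f => ⟨f.1 0, Fin.tail f.1, fun y hy => by
          obtain ⟨x, hx⟩ := f.2 y
          rcases Fin.eq_zero_or_eq_succ x with rfl | ⟨x, rfl⟩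
          · exact absurd hx.symm hy
          · exact ⟨x, hx⟩⟩
        invFun := fun s => ⟨Fin.cons s.1 s.2.1, fun y => by
          rcases eq_or_ne y s.1 with rfl | hy
          · exact ⟨0, rfl⟩
          · obtain ⟨x, hx⟩ := s.2.2 y hy
            exact ⟨x.succ, by simpa using hx⟩⟩
        left_inv := fun f => Subtype.ext (Fin.cons_self_tail f.1)
        right_inv := fun s => by
          obtain ⟨v, f, hf⟩ := s
          rfl }
    rw [Nat.card_congr e]
    have := Fintype.ofFinite β
    rw [Nat.card_sigma]
    rcases isEmpty_or_nonempty β with hβ | hβ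
    · simp
    · obtain ⟨k, hk⟩ := Nat.exists_eq_add_one_of_ne_zero (Nat.card_pos (α := β)).ne'
      have hc (v : β) : Nat.card {y : β // y ≠ v} = k := by
        classical
        have := Fintype.card_subtype_compl (fun y : β => y = v)
        rw [Nat.card_eq_fintype_card] at hk ⊢
        simp_all
      simp_rw [card_covering_except, ih, hc, hk]
      rw [Finset.sum_const, Finset.card_univ, ← Nat.card_eq_fintype_card, hk,
        Nat.stirlingSecond_succ_succ, Nat.factorial_succ, smul_eq_mul]
      ring

/-- Shifting the index turns the sum over ordered pairs of partitions into a sum over pairs of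
surjections and almost-surjections. -/
theorem sum_factorial_stirling_eq (n : ℕ) :
    ∑ k ∈ Finset.Icc 1 n,
        (k - 1).factorial * k.factorial * Nat.stirlingSecond n k * Nat.stirlingSecond (n + 1) k =
      ∑ k : Fin n, (k + 1 : ℕ).factorial * Nat.stirlingSecond n (k + 1) *
        ((k + 1 : ℕ).factorial * Nat.stirlingSecond n (k + 1) +
          (k + 2 : ℕ).factorial * Nat.stirlingSecond n (k + 2)) := by
  rcases n with _ | m
  · simp
  set n := m + 1 with hn
  set u : ℕ → ℕ := fun k => k.factorial * Nat.stirlingSecond n k with hu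
  -- Both boundary terms of the shift vanish. At the lower end this needs `n ≥ 1`, hence the
  -- separate case `n = 0`.
  have h0 : u 0 = 0 := by simp [hu, hn]
  have hlast : u (n + 1) = 0 := by simp [hu, Nat.stirlingSecond_eq_zero_of_lt]
  have hshift : ∑ k ∈ Finset.range n, u (k + 1) * u (k + 2) =
      ∑ k ∈ Finset.range n, u k * u (k + 1) := by
    have h := Finset.sum_range_succ (fun k => u k * u (k + 1)) n
    rw [Finset.sum_range_succ', h0, hlast] at h
    simpa using h
  rw [Fin.sum_univ_eq_sum_range (fun k => (k + 1 : ℕ).factorial * Nat.stirlingSecond n (k + 1) *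
        ((k + 1 : ℕ).factorial * Nat.stirlingSecond n (k + 1) +
          (k + 2 : ℕ).factorial * Nat.stirlingSecond n (k + 2))) n]
  change _ = ∑ k ∈ Finset.range n, u (k + 1) * (u (k + 1) + u (k + 2))
  simp_rw [mul_add]
  rw [Finset.sum_add_distrib, hshift, ← Finset.sum_add_distrib, Finset.range_eq_Ico,
    ← Finset.Ico_add_one_right_eq_Icc, ← zero_add 1, ← Finset.sum_Ico_add']
  refine Finset.sum_congr rfl fun k _ => ?_
  simp only [hu, zero_add, Nat.add_sub_cancel, Nat.stirlingSecond_succ_succ, Nat.factorial_succ]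
  ring

/-! ### The rank bound for unambiguous automata -/

namespace NFA

variable {α σ : Type*}

theorem exists_run_of_mem_evalFrom (M : NFA α σ) (w : List α) {s t : σ}
    (h : s ∈ M.evalFrom {t} w) :
    ∃ p : ℕ → σ, p 0 = t ∧ (∀ i (hi : i < w.length), p (i + 1) ∈ M.step (p i) w[i]) ∧
      p w.length = s := by
  induction w generalizing t with
  | nil => exact ⟨fun _ => t, rfl, by simp, by simpa using h.symm⟩
  | cons a w ih =>
    rw [evalFrom_cons, stepSet_singleton, mem_evalFrom_iff_exists] at h
    obtain ⟨r, hr, hs⟩ := h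
    obtain ⟨p, hp0, hp, hpl⟩ := ih hs
    refine ⟨fun i => i.casesOn t p, rfl, ?_, by simpa using hpl⟩
    rintro (_ | i) hi
    · simpa [hp0] using hr
    · simpa using hp i (by simpa using hi)

/-- A state reached on `u` from which `v` is accepted lies on an accepting run on `u ++ v`. -/
theorem exists_isAcceptingRun_append (M : NFA α σ) {u v : List α} {q : σ} (hu : q ∈ M.eval u)
    (hv : v ∈ M.acceptsFrom {q}) :
    ∃ p, M.IsAcceptingRun (u ++ v) p ∧ p ⟨u.length, by simp⟩ = q := by
  rw [eval, mem_evalFrom_iff_exists] at hu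
  obtain ⟨s, hs, hu⟩ := hu
  obtain ⟨t, ht, hv⟩ := hv
  obtain ⟨p, hp0, hp, hpl⟩ := M.exists_run_of_mem_evalFrom u hu
  obtain ⟨r, hr0, hr, hrl⟩ := M.exists_run_of_mem_evalFrom v hv
  refine ⟨fun i => if i.1 ≤ u.length then p i else r (i - u.length), ⟨?_, ?_, ?_⟩, ?_⟩
  · simpa [hp0] using hs
  · rintro ⟨i, hi⟩
    rw [List.length_append] at hi
    simp only [Fin.val_succ, Fin.val_castSucc, List.get_eq_getElem]
    rcases lt_trichotomy i u.length with h | h | h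
    · rw [if_pos (by omega), if_pos (by omega), List.getElem_append_left h]
      exact hp i h
    · subst h
      have := hr 0 (by omega)
      rw [if_neg (Nat.not_succ_le_self _), if_pos (le_refl u.length),
        List.getElem_append_right le_rfl, hpl]
      simpa [hr0] using this
    · have := hr (i - u.length) (by omega)
      rw [if_neg (by omega), if_neg (by omega), List.getElem_append_right h.le]
      rwa [show i + 1 - u.length = i - u.length + 1 by omega]
  · rcases v with _ | ⟨a, v⟩
    · simp_all
    · simpa [← hrl] using ht
  · simpa using hpl

theorem IsUnambiguous.eq_of_mem_eval {M : NFA α σ} (hM : M.IsUnambiguous) {u v : List α}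
    {q q' : σ} (hq : q ∈ M.eval u) (hq' : q' ∈ M.eval u) (hv : v ∈ M.acceptsFrom {q})
    (hv' : v ∈ M.acceptsFrom {q'}) : q = q' := by
  obtain ⟨p, hp, rfl⟩ := M.exists_isAcceptingRun_append hq hv
  obtain ⟨p', hp', rfl⟩ := M.exists_isAcceptingRun_append hq' hv'
  rw [hM _ p p' hp hp']

theorem append_mem_accepts_iff (M : NFA α σ) (u v : List α) :
    u ++ v ∈ M.accepts ↔ ∃ q ∈ M.eval u, v ∈ M.acceptsFrom {q} := by
  change (∃ s ∈ M.accept, s ∈ M.evalFrom M.start (u ++ v)) ↔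
    ∃ q ∈ M.evalFrom M.start u, ∃ s ∈ M.accept, s ∈ M.evalFrom {q} v
  simp_rw [evalFrom_append]
  constructor
  · rintro ⟨s, hs, h⟩
    obtain ⟨q, hq, h⟩ := mem_evalFrom_iff_exists.1 h
    exact ⟨q, hq, s, hs, h⟩
  · rintro ⟨q, hq, s, hs, h⟩
    exact ⟨s, hs, mem_evalFrom_iff_exists.2 ⟨q, hq, h⟩⟩

open Classical in
/-- An unambiguous automaton has at least as many states as there are strings whose rows of the
acceptance matrix are linearly independent. -/
theorem IsUnambiguous.card_le_card_states {ι : Type*} [Fintype ι] [Fintype σ] (K : Type*)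
    [Field K] {M : NFA α σ} (hM : M.IsUnambiguous) (u : ι → List α)
    (h : ∀ c : ι → K, (∀ v, ∑ i, c i * (if u i ++ v ∈ M.accepts then 1 else 0) = 0) →
      ∀ i, c i = 0) :
    Fintype.card ι ≤ Fintype.card σ := by
  have hli : LinearIndependent K
      (fun i => (fun q => if q ∈ M.eval (u i) then 1 else 0 : σ → K)) := by
    rw [Fintype.linearIndependent_iff]
    intro c hc
    refine h c fun v => ?_
    -- Unambiguity leaves at most one nonzero summand, so the count of accepting midpoints is the
    -- truth value itself, in any characteristic.
    have key (i : ι) : (if u i ++ v ∈ M.accepts then 1 else 0 : K) =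
        ∑ q, (if q ∈ M.eval (u i) then 1 else 0) * (if v ∈ M.acceptsFrom {q} then 1 else 0) := by
      rw [append_mem_accepts_iff]
      split_ifs with hq
      · obtain ⟨q, hq, hv⟩ := hq
        rw [Finset.sum_eq_single q]
        · simp [hq, hv]
        · intro q' _ hne
          by_contra h0
          simp only [mul_ite, mul_one, mul_zero, ite_eq_right_iff, Classical.not_imp] at h0
          exact hne (hM.eq_of_mem_eval h0.2.1 hq h0.1 hv)
        · simp
      · symm
        refine Finset.sum_eq_zero fun q _ => ?_
        by_cases hqu : q ∈ M.eval (u i)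
        · rw [if_neg fun hv => hq ⟨q, hqu, hv⟩, mul_zero]
        · rw [if_neg hqu, zero_mul]
    simp_rw [key, Finset.mul_sum]
    rw [Finset.sum_comm]
    refine Finset.sum_eq_zero fun q _ => ?_
    have := congrFun hc q
    simp only [Finset.sum_apply, Pi.smul_apply, smul_eq_mul, Pi.zero_apply] at this
    simp_rw [← mul_assoc]
    rw [← Finset.sum_mul, this, zero_mul]
  simpa using hli.fintype_card_le_finrank

end NFA

/-! ### Suffix tables whose values form a chain -/

/-- The suffix table with `x ∈ g q` iff `e x ≤ c q`, where the values with `k ≤ c q` are full. -/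
def SuffixTable.ofLevels {n : ℕ} (k : ℕ) (c e : Fin n → ℕ) (h : ∃ q, k ≤ c q) : SuffixTable n :=
  ⟨fun q => Finset.univ.filter fun y => k ≤ c q ∨ ∃ x, y = some x ∧ e x ≤ c q,
    h.imp fun q hq => by simp [hq], fun q hq => by simp_all⟩

theorem SuffixTable.none_mem_ofLevels {n k : ℕ} {c e : Fin n → ℕ} (h : ∃ q, k ≤ c q) (q : Fin n) :
    none ∈ (SuffixTable.ofLevels k c e h).1 q ↔ k ≤ c q := by
  simp [ofLevels]

theorem SuffixTable.some_mem_ofLevels {n k : ℕ} {c e : Fin n → ℕ} (h : ∃ q, k ≤ c q)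
    (q x : Fin n) :
    some x ∈ (SuffixTable.ofLevels k c e h).1 q ↔ k ≤ c q ∨ e x ≤ c q := by
  simp [ofLevels]

/-- Whether the computation on `f` started in `i` can leave every level `j < k` upwards: some state
in `f i` or in `f x` with `e x ≤ j` has level above `j`. -/
def ClimbsLevels {n : ℕ} (k : ℕ) (f : Fin n → Finset (Fin n)) (i : Fin n) (c e : Fin n → ℕ) :
    Prop :=
  ∀ j < k, ∃ q, j < c q ∧ (q ∈ f i ∨ ∃ x, e x ≤ j ∧ q ∈ f x)

/-- The suffix table sends a state of level `j < k` back to exactly the states `x` with `e x ≤ j`. A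
computation that never exceeds level `j` therefore sees only these `x` and `i`, and if none of them
leads above `j`, it is trapped. -/
theorem mem_language_iff_climbsLevels {n k : ℕ} (hk : 0 < k) (f : PrefixTable n) (i : Fin n)
    (c e : Fin n → ℕ) (he : ∀ x, 1 ≤ e x) (h : ∃ q, k ≤ c q) :
    [.leftState i, .leftTable f] ++ [.rightTable (SuffixTable.ofLevels k c e h)] ∈
        (universalTwoNFA n).language ↔
      ClimbsLevels k f.1 i c e := by
  set w : List (UniversalAlphabet n) :=
    [.leftState i, .leftTable f] ++ [.rightTable (SuffixTable.ofLevels k c e h)] with hw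
  have hlen : w.length = 3 := rfl
  have h0 : TwoNFA.symbolAt w 0 = .leftEnd := rfl
  have h1 : TwoNFA.symbolAt w 1 = .letter (.leftState i) := rfl
  have h2 : TwoNFA.symbolAt w 2 = .letter (.leftTable f) := rfl
  have h3 : TwoNFA.symbolAt w 3 = .letter (.rightTable (SuffixTable.ofLevels k c e h)) := rfl
  have h4 : TwoNFA.symbolAt w 4 = .rightEnd := rfl
  constructor
  · rintro ⟨q₀, -, q, -, hreach⟩ j hj
    by_contra hno
    push Not at hno
    have inv : ∀ d : Fin n × ℕ, Relation.ReflTransGen ((universalTwoNFA n).Move w) (q₀, 0) d →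
        d.2 ≤ 1 ∨ (d.2 = 2 ∧ (d.1 = i ∨ e d.1 ≤ j)) ∨
          (d.2 = 3 ∧ (d.1 ∈ f.1 i ∨ ∃ x, e x ≤ j ∧ d.1 ∈ f.1 x)) := by
      intro d hd
      induction hd with
      | refl => exact Or.inl (Nat.zero_le _)
      | tail _ hm ih =>
        rename_i d d' _
        obtain ⟨s, m⟩ := d
        obtain ⟨s', m'⟩ := d'
        obtain ⟨-, hm⟩ := hm
        simp only at hm ih ⊢
        rcases ih with ih | ⟨rfl, ih⟩ | ⟨rfl, ih⟩
        · rcases Nat.le_one_iff_eq_zero_or_eq_one.1 ih with rfl | rfl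
          · left; omega
          · simp [h1, universalTwoNFA, universalStep] at hm
            right; left; omega
        · simp only [h2, universalTwoNFA, universalStep, Set.mem_ofPred_eq] at hm
          rcases hm with ⟨⟨hm, -⟩, rfl⟩ | ⟨⟨-, hm⟩, -⟩
          · right; right
            refine ⟨rfl, ?_⟩
            rcases ih with rfl | ih
            · exact Or.inl hm
            · exact Or.inr ⟨s, ih, hm⟩
          · cases hm
        · have hc : c s ≤ j := by
            by_contra hlt
            obtain ⟨hn1, hn2⟩ := hno s (by omega)
            rcases ih with ih | ⟨x, hx, ih⟩
            · exact hn1 ih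
            · exact hn2 x hx ih
          simp only [h3, universalTwoNFA, universalStep, SuffixTable.none_mem_ofLevels,
            if_neg (show ¬ k ≤ c s by omega), Set.mem_ofPred_eq,
            SuffixTable.some_mem_ofLevels] at hm
          rcases hm with ⟨⟨-, hm⟩, -⟩ | ⟨⟨hm, -⟩, hm'⟩
          · cases hm
          · right; left
            omega
    have := inv _ hreach
    simp only [hlen] at this
    omega
  · intro hclimb
    have hn : 0 < n := i.pos
    let q₀ : Fin n := ⟨0, hn⟩
    have hi : Relation.ReflTransGen ((universalTwoNFA n).Move w) (q₀, 0) (i, 2) := by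
      refine (Relation.ReflTransGen.single (b := (q₀, 1)) ?_).tail ?_
      · exact ⟨by simp [hlen], Or.inl ⟨by simp [h0, universalTwoNFA, universalStep], rfl⟩⟩
      · exact ⟨by simp [hlen], Or.inl ⟨by simp [h1, universalTwoNFA, universalStep], rfl⟩⟩
    have hf {x q : Fin n} (hx : Relation.ReflTransGen ((universalTwoNFA n).Move w) (q₀, 0) (x, 2))
        (hq : q ∈ f.1 x) :
        Relation.ReflTransGen ((universalTwoNFA n).Move w) (q₀, 0) (q, 3) :=
      hx.tail ⟨by simp [hlen], Or.inl ⟨by simpa [h2, universalTwoNFA, universalStep] using hq, rfl⟩⟩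
    have climb : ∀ j < k, ∃ q, j < c q ∧
        Relation.ReflTransGen ((universalTwoNFA n).Move w) (q₀, 0) (q, 3) := by
      have hstep (j : ℕ) (hj : j < k) (hprev : ∀ x, e x ≤ j →
          (∃ q, j < c q ∧ Relation.ReflTransGen ((universalTwoNFA n).Move w) (q₀, 0) (q, 3)) ∨
          Relation.ReflTransGen ((universalTwoNFA n).Move w) (q₀, 0) (x, 2)) :
          ∃ q, j < c q ∧ Relation.ReflTransGen ((universalTwoNFA n).Move w) (q₀, 0) (q, 3) := by
        obtain ⟨q, hq, hqi | ⟨x, hx, hqx⟩⟩ := hclimb j hj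
        · exact ⟨q, hq, hf hi hqi⟩
        · exact (hprev x hx).elim id fun hx => ⟨q, hq, hf hx hqx⟩
      intro j
      induction j with
      -- As `1 ≤ e x`, only `i` is available at level 0. A state with `e x = 0` would count for
      -- `ClimbsLevels` without having been reached.
      | zero =>
        intro hj
        exact hstep 0 hj fun x hx => absurd hx (by have := he x; omega)
      | succ j ih =>
        intro hj
        obtain ⟨q, hq, hreach⟩ := ih (by omega)
        refine hstep _ hj fun x hx => ?_
        -- Otherwise `c q = j + 1 < k`, so the value at `q` is not full and the head returns to
        -- every `x` with `e x ≤ j + 1`.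
        by_cases hlt : j + 1 < c q
        · exact Or.inl ⟨q, hlt, hreach⟩
        · right
          refine hreach.tail ⟨by simp [hlen], Or.inr ⟨?_, rfl⟩⟩
          have hck : ¬ k ≤ c q := by omega
          simp only [h3, universalTwoNFA, universalStep, SuffixTable.none_mem_ofLevels,
            if_neg hck, Set.mem_ofPred_eq, SuffixTable.some_mem_ofLevels]
          exact ⟨Or.inr (by omega), trivial⟩
    obtain ⟨q, hq, hreach⟩ := climb (k - 1) (by omega)
    refine ⟨q₀, rfl, q, trivial, hreach.tail ⟨by simp [hlen], Or.inl ⟨?_, rfl⟩⟩⟩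
    have hck : k ≤ c q := by omega
    simp [h3, universalTwoNFA, universalStep, SuffixTable.none_mem_ofLevels, hck]

/-! ### Sums modulo two over families of suffix tables -/

section Parity

variable {τ : Type*}

theorem sum_powerset_one_zmod_two {s : Finset τ} (hs : s.Nonempty) :
    ∑ _t ∈ s.powerset, (1 : ZMod 2) = 0 := by
  rw [Finset.sum_const, Finset.card_powerset, nsmul_one, Nat.cast_pow,
    show ((2 : ℕ) : ZMod 2) = 0 from rfl, zero_pow hs.card_ne_zero]

/-- The number of subsets of `s` that contain an element with property `P` is odd iff all elements
of `s` have the property. -/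
theorem sum_powerset_exists_zmod_two {s : Finset τ} (hs : s.Nonempty) (P : τ → Prop)
    [∀ t : Finset τ, Decidable (∃ x ∈ t, P x)] [Decidable (∀ x ∈ s, P x)] :
    ∑ t ∈ s.powerset, (if ∃ x ∈ t, P x then 1 else 0 : ZMod 2) =
      if ∀ x ∈ s, P x then 1 else 0 := by
  classical
  have hsplit : ∑ t ∈ s.powerset, (if ∃ x ∈ t, P x then 1 else 0 : ZMod 2) +
      ∑ t ∈ s.powerset, (if ∀ x ∈ t, ¬ P x then 1 else 0 : ZMod 2) = 0 := by
    rw [← Finset.sum_add_distrib]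
    refine Eq.trans ?_ (sum_powerset_one_zmod_two hs)
    refine Finset.sum_congr rfl fun t _ => ?_
    by_cases h : ∃ x ∈ t, P x
    · rw [if_pos h, if_neg (by push Not; exact h), add_zero]
    · rw [if_neg h, if_pos (by push Not at h; exact h), zero_add]
  -- The complementary subsets form the powerset of the elements failing `P`, whose size is odd only
  -- if there are no such elements.
  have hnone : ∑ t ∈ s.powerset, (if ∀ x ∈ t, ¬ P x then 1 else 0 : ZMod 2) =
      ∑ _t ∈ (s.filter fun x => ¬ P x).powerset, (1 : ZMod 2) := by
    rw [← Finset.sum_filter]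
    refine Finset.sum_congr ?_ fun _ _ => rfl
    ext t
    simp only [Finset.mem_filter, Finset.mem_powerset, Finset.subset_iff]
    grind
  rw [hnone] at hsplit
  split_ifs with hall
  · rw [Finset.filter_false_of_mem (by simpa using hall)] at hsplit
    simp only [Finset.powerset_empty, Finset.sum_singleton] at hsplit
    exact (eq_neg_of_add_eq_zero_left hsplit).trans (by decide)
  · push Not at hall
    obtain ⟨x, hx, hP⟩ := hall
    rwa [sum_powerset_one_zmod_two ⟨x, Finset.mem_filter.2 ⟨hx, hP⟩⟩, add_zero] at hsplit

end Parity

/-! ### Raising states within levels, and the factorization of the sum -/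

section Perturbation

variable {n : ℕ}

/-- State `q` can be entered from the left part when the columns of level below `j` and those of
level `j` in `V` are available. -/
def Enters (f : Fin n → Finset (Fin n)) (i : Fin n) (a : Fin n → ℕ) (j : ℕ) (V : Finset (Fin n))
    (q : Fin n) : Prop :=
  q ∈ f i ∨ ∃ x, 1 ≤ a x ∧ (a x < j ∨ a x = j ∧ x ∈ V) ∧ q ∈ f x

/-- Row levels: `q` is raised above `b q` if it is selected. -/
def raisedRow {k : ℕ} (b : Fin n → ℕ) (p : Fin k → Finset (Fin n) × Finset (Fin n)) (q : Fin n) :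
    ℕ :=
  if h : b q < k then if q ∈ (p ⟨b q, h⟩).1 then b q + 1 else b q else 0

/-- Column levels: `x` is raised above `a x` if it is not selected, and to the top if `a x = 0`. -/
def raisedCol {k : ℕ} (a : Fin n → ℕ) (p : Fin k → Finset (Fin n) × Finset (Fin n)) (x : Fin n) :
    ℕ :=
  if h : a x < k then
    if a x = 0 then k else if x ∈ (p ⟨a x, h⟩).2 then a x else a x + 1
  else k

theorem one_le_raisedCol {k : ℕ} (hk : 0 < k) (a : Fin n → ℕ)
    (p : Fin k → Finset (Fin n) × Finset (Fin n)) (x : Fin n) : 1 ≤ raisedCol a p x := by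
  unfold raisedCol
  split_ifs <;> omega

/-- The perturbations of a single level. -/
def levelChoices (a b : Fin n → ℕ) (j : ℕ) : Finset (Finset (Fin n) × Finset (Fin n)) :=
  (Finset.univ.filter fun q => b q = j).powerset ×ˢ
    (Finset.univ.filter fun x => a x = j ∧ 1 ≤ j).powerset

/-- A state moves by at most one level, except those sent to the unused extremes, so whether level
`j` can be left depends on `p j` alone. This locality is what makes the sum over perturbations
factor. -/
theorem climbsLevels_raised_iff {k : ℕ} (f : Fin n → Finset (Fin n)) (i : Fin n)
    (a b : Fin n → ℕ) (p : Fin k → Finset (Fin n) × Finset (Fin n)) :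
    ClimbsLevels k f i (raisedRow b p) (raisedCol a p) ↔
      ∀ j : Fin k, ∃ q, b q < k ∧ ((j : ℕ) < b q ∨ b q = j ∧ q ∈ (p j).1) ∧
        Enters f i a j (p j).2 q := by
  have hrow (j : Fin k) (q : Fin n) :
      (j : ℕ) < raisedRow b p q ↔ b q < k ∧ ((j : ℕ) < b q ∨ b q = j ∧ q ∈ (p j).1) := by
    unfold raisedRow
    split_ifs with h hq
    · have : b q = j → (q ∈ (p j).1 ↔ True) := fun h' => by
        simpa [show (⟨b q, h⟩ : Fin k) = j from Fin.ext h'] using hq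
      constructor
      · intro h1
        refine ⟨h, ?_⟩
        rcases (Nat.lt_succ_iff.1 h1).lt_or_eq with h2 | h2
        · exact Or.inl h2
        · exact Or.inr ⟨h2.symm, (this h2.symm).2 trivial⟩
      · rintro ⟨-, h1 | h1⟩ <;> omega
    · refine ⟨fun h1 => ⟨h, Or.inl h1⟩, ?_⟩
      rintro ⟨-, h1 | ⟨h1, h2⟩⟩
      · exact h1
      · exact absurd (by simpa [show (⟨b q, h⟩ : Fin k) = j from Fin.ext h1] using h2) hq
    · simp [h]
  have hcol (j : Fin k) (x : Fin n) :
      raisedCol a p x ≤ j ↔ 1 ≤ a x ∧ (a x < j ∨ a x = j ∧ x ∈ (p j).2) := by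
    have hj := j.2
    unfold raisedCol
    split_ifs with h h0 hx
    · omega
    · constructor
      · intro h1
        refine ⟨by omega, ?_⟩
        rcases h1.lt_or_eq with h2 | h2
        · exact Or.inl h2
        · exact Or.inr ⟨h2, by simpa [show (⟨a x, h⟩ : Fin k) = j from Fin.ext h2] using hx⟩
      · omega
    · constructor
      · intro h1
        exact ⟨by omega, Or.inl (by omega)⟩
      · rintro ⟨-, h1 | ⟨h1, h2⟩⟩
        · omega
        · exact absurd (by simpa [show (⟨a x, h⟩ : Fin k) = j from Fin.ext h1] using h2) hx
    · omega
  constructor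
  · intro h j
    obtain ⟨q, hq, hE⟩ := h j j.2
    obtain ⟨h1, h2⟩ := (hrow j q).1 hq
    refine ⟨q, h1, h2, hE.imp id ?_⟩
    rintro ⟨x, hx, hqx⟩
    obtain ⟨h3, h4⟩ := (hcol j x).1 hx
    exact ⟨x, h3, h4, hqx⟩
  · intro h j hj
    obtain ⟨q, h1, h2, hE⟩ := h ⟨j, hj⟩
    refine ⟨q, (hrow ⟨j, hj⟩ q).2 ⟨h1, h2⟩, hE.imp id ?_⟩
    rintro ⟨x, h3, h4, hqx⟩
    exact ⟨x, (hcol ⟨j, hj⟩ x).2 ⟨h3, h4⟩, hqx⟩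

/-- All states of level `j` and none of those above it can be entered. -/
def EntersExactly (k : ℕ) (f : Fin n → Finset (Fin n)) (i : Fin n) (a b : Fin n → ℕ) (j : ℕ)
    (V : Finset (Fin n)) : Prop :=
  (∀ q, b q = j → Enters f i a j V q) ∧ ∀ q, j < b q → b q < k → ¬ Enters f i a j V q

open Classical in
/-- The contribution of level `j` to the sum over all perturbations. -/
noncomputable def levelSum (k : ℕ) (f : Fin n → Finset (Fin n)) (i : Fin n) (a b : Fin n → ℕ)
    (j : ℕ) : ZMod 2 :=
  ∑ V ∈ (Finset.univ.filter fun x => a x = j ∧ 1 ≤ j).powerset,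
    if EntersExactly k f i a b j V then 1 else 0

open Classical in
-- With `V` fixed, consider the sets `Z` of raised rows of level `j`. If a row above `j` is entered,
-- every `Z` counts, an even number; otherwise `Z` must meet the entered rows, which happens an odd
-- number of times iff the whole level is entered.
theorem sum_climbsLevels_eq_prod {k : ℕ} (f : Fin n → Finset (Fin n)) (i : Fin n)
    (a b : Fin n → ℕ) (hb : ∀ j < k, ∃ q, b q = j) :
    ∑ p ∈ Fintype.piFinset fun j : Fin k => levelChoices a b j,
        (if ClimbsLevels k f i (raisedRow b p) (raisedCol a p) then 1 else 0 : ZMod 2) =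
      ∏ j : Fin k, levelSum k f i a b j := by
  have hlevel (j : Fin k) : levelSum k f i a b j = ∑ z ∈ levelChoices a b j,
      if ∃ q, b q < k ∧ ((j : ℕ) < b q ∨ b q = j ∧ q ∈ z.1) ∧ Enters f i a j z.2 q
      then 1 else 0 := by
    rw [levelChoices, Finset.sum_product_right, levelSum]
    refine Finset.sum_congr rfl fun V _ => ?_
    have hne : (Finset.univ.filter fun q => b q = j).Nonempty := by
      obtain ⟨q, hq⟩ := hb j j.2
      exact ⟨q, by simpa using hq⟩
    by_cases habove : ∃ q, (j : ℕ) < b q ∧ b q < k ∧ Enters f i a j V q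
    · obtain ⟨q, h1, h2, h3⟩ := habove
      rw [if_neg fun h => h.2 q h1 h2 h3, ← sum_powerset_one_zmod_two hne]
      refine Finset.sum_congr rfl fun Z _ => ?_
      rw [if_pos ⟨q, h2, Or.inl h1, h3⟩]
    · push Not at habove
      have := sum_powerset_exists_zmod_two hne fun q => Enters f i a j V q
      have hl : EntersExactly k f i a b j V ↔
          ∀ q ∈ Finset.univ.filter fun q => b q = j, Enters f i a j V q := by
        simp only [Finset.mem_filter, Finset.mem_univ, true_and]
        exact ⟨fun h => h.1, fun h => ⟨h, habove⟩⟩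
      refine (if_congr hl rfl rfl).trans (this.symm.trans ?_)
      refine Finset.sum_congr rfl fun Z hZ => if_congr ?_ rfl rfl
      have hZ' : ∀ q ∈ Z, b q = j := fun q hq => by
        simpa using Finset.mem_powerset.1 hZ hq
      constructor
      · rintro ⟨q, hq, hE⟩
        exact ⟨q, hZ' q hq ▸ j.2, Or.inr ⟨hZ' q hq, hq⟩, hE⟩
      · rintro ⟨q, h1, h2 | ⟨-, h2⟩, hE⟩
        · exact absurd hE (habove q h2 h1)
        · exact ⟨q, h2, hE⟩
  simp_rw [hlevel]
  rw [Finset.prod_univ_sum]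
  refine Finset.sum_congr rfl fun p _ => ?_
  refine Eq.trans ?_ Finset.prod_boole.symm
  simp_rw [climbsLevels_raised_iff, Finset.mem_univ, true_imp_iff]

end Perturbation

/-! ### Triangularity -/

section Triangular

variable {n : ℕ}

/-- The chain of sets given by levels: `q` belongs to the value at `x` iff `b q ≤ a x`. -/
def chainMap (a b : Fin n → ℕ) (x : Fin n) : Finset (Fin n) :=
  Finset.univ.filter fun q => b q ≤ a x

theorem mem_chainMap {a b : Fin n → ℕ} {x q : Fin n} : q ∈ chainMap a b x ↔ b q ≤ a x := by
  simp [chainMap]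

variable {k k' : ℕ} {a b a' b' : Fin n → ℕ} {i : Fin n}

/-- The states that can be entered are those up to some level of the chain. -/
theorem exists_enters_chainMap_iff (j : ℕ) (V : Finset (Fin n)) :
    ∃ y, ∀ q, Enters (chainMap a' b') i a j V q ↔ b' q ≤ a' y := by
  classical
  -- In a chain, the union over the available columns is the value at the highest of them.
  obtain ⟨y, hy, hmax⟩ := Finset.exists_max_image
    (Finset.univ.filter fun y => y = i ∨ 1 ≤ a y ∧ (a y < j ∨ a y = j ∧ y ∈ V)) a'
    ⟨i, by simp⟩
  simp only [Finset.mem_filter, Finset.mem_univ, true_and] at hy hmax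
  refine ⟨y, fun q => ⟨?_, fun hq => ?_⟩⟩
  · rintro (h | ⟨x, h1, h2, h⟩)
    · exact (mem_chainMap.1 h).trans (hmax i (Or.inl rfl))
    · exact (mem_chainMap.1 h).trans (hmax x (Or.inr ⟨h1, h2⟩))
  · rcases hy with rfl | hy
    · exact Or.inl (mem_chainMap.2 hq)
    · exact Or.inr ⟨y, hy.1, hy.2, mem_chainMap.2 hq⟩

/-- For each `j` some level `m j < k'` of the primed chain separates the rows of level `j` from
those above it. Rows of level `j + 1` make `m` strictly increasing, so `k ≤ k'`; if `k = k'`, then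
`m` is the identity and the rows are determined. -/
theorem row_levels_of_levelSum_ne_zero (hb : ∀ j < k, ∃ q, b q = j) (ha' : ∀ x, a' x < k')
    (h : ∀ j < k, levelSum k (chainMap a' b') i a b j ≠ 0) :
    k ≤ k' ∧ (k = k' → ∀ q, b q < k → b' q = b q) := by
  have hm : ∀ j, ∃ m, j < k → m < k' ∧ (∀ q, b q = j → b' q ≤ m) ∧
      ∀ q, j < b q → b q < k → m < b' q := by
    intro j
    by_cases hj : j < k
    · obtain ⟨V, -, hV⟩ := Finset.exists_ne_zero_of_sum_ne_zero (h j hj)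
      have hV' : EntersExactly k (chainMap a' b') i a b j V := by
        by_contra h0
        exact hV (if_neg h0)
      obtain ⟨y, hy⟩ := exists_enters_chainMap_iff (a := a) (a' := a') (b' := b') (i := i) j V
      exact ⟨a' y, fun _ => ⟨ha' y, fun q hq => (hy q).1 (hV'.1 q hq),
        fun q h1 h2 => not_le.1 fun h3 => hV'.2 q h1 h2 ((hy q).2 h3)⟩⟩
    · exact ⟨0, fun h => absurd h hj⟩
  choose m hm using hm
  have hlt (j : ℕ) (hj : j + 1 < k) : m j < m (j + 1) := by
    obtain ⟨q, hq⟩ := hb (j + 1) hj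
    exact ((hm j (by omega)).2.2 q (by omega) (by omega)).trans_le ((hm (j + 1) hj).2.1 q hq)
  have hlow : ∀ j < k, j ≤ m j := by
    intro j
    induction j with
    | zero => simp
    | succ j ih =>
      intro hj
      have := hlt j hj
      have := ih (by omega)
      omega
  have hup : ∀ t < k, m (k - 1 - t) + t < k' := by
    intro t
    induction t with
    | zero => exact fun ht => (hm _ (by omega)).1
    | succ t ih =>
      intro ht
      have h1 := ih (by omega)
      have h2 := hlt (k - 1 - (t + 1)) (by omega)
      rw [show k - 1 - (t + 1) + 1 = k - 1 - t by omega] at h2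
      omega
  constructor
  · rcases Nat.eq_zero_or_pos k with rfl | hk
    · exact Nat.zero_le _
    · have h1 := hlow (k - 1) (by omega)
      have h2 := (hm (k - 1) (by omega)).1
      omega
  · rintro rfl q hq
    have hmj : ∀ j < k, m j = j := by
      intro j hj
      have h1 := hlow j hj
      have h2 := hup (k - 1 - j) (by omega)
      rw [show k - 1 - (k - 1 - j) = j by omega] at h2
      omega
    have h1 := (hm (b q) hq).2.1 q rfl
    rw [hmj _ hq] at h1
    rcases Nat.eq_zero_or_pos (b q) with h0 | h0
    · omega
    · have h2 := (hm (b q - 1) (by omega)).2.2 q (by omega) hq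
      rw [hmj _ (by omega)] at h2
      omega

open Classical in
-- By `hle` no available column reaches above `j`, and `i` reaches only level 0, so the question is
-- whether some available column has primed level `j`. If one of level below `j` does, every `V`
-- counts and the sum is even; otherwise the parity lemma applies to `V`.
theorem levelSum_chainMap (hb : ∀ j < k, ∃ q, b q = j) (hbb : ∀ q, b q < k → b' q = b q)
    (hi : a' i = 0) (ha : ∀ j < k, ∃ x, a x = j) {j : ℕ} (hj : 1 ≤ j) (hjk : j < k)
    (hle : ∀ x, 1 ≤ a x → a x ≤ j → a' x ≤ j) :
    levelSum k (chainMap a' b') i a b j =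
      if ∃ x, 1 ≤ a x ∧ a x < j ∧ a' x = j then 0
      else if ∀ x, a x = j → a' x = j then 1 else 0 := by
  have hne : (Finset.univ.filter fun x => a x = j ∧ 1 ≤ j).Nonempty := by
    obtain ⟨x, hx⟩ := ha j hjk
    exact ⟨x, by simp [hx, hj]⟩
  have hiff (V : Finset (Fin n))
      (hV : V ∈ (Finset.univ.filter fun x => a x = j ∧ 1 ≤ j).powerset) :
      EntersExactly k (chainMap a' b') i a b j V ↔
        (∃ x, 1 ≤ a x ∧ a x < j ∧ a' x = j) ∨ ∃ x ∈ V, a' x = j := by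
    have hVj : ∀ x ∈ V, a x = j := fun x hx => by
      have := Finset.mem_powerset.1 hV hx
      simp at this
      exact this.1
    constructor
    · rintro ⟨h1, -⟩
      obtain ⟨q, hq⟩ := hb j hjk
      have hq' := hbb q (by omega)
      rcases h1 q hq with h | ⟨x, h2, h3, h⟩
      · have := mem_chainMap.1 h
        omega
      · have := mem_chainMap.1 h
        have := hle x h2 (by omega)
        rcases h3 with h3 | ⟨-, h3⟩
        · exact Or.inl ⟨x, h2, h3, by omega⟩
        · exact Or.inr ⟨x, h3, by omega⟩
    · intro h
      constructor
      · intro q hq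
        have hq' := hbb q (by omega)
        rcases h with ⟨x, h1, h2, h3⟩ | ⟨x, h1, h3⟩
        · exact Or.inr ⟨x, h1, Or.inl h2, mem_chainMap.2 (by omega)⟩
        · have := hVj x h1
          exact Or.inr ⟨x, by omega, Or.inr ⟨this, h1⟩, mem_chainMap.2 (by omega)⟩
      · rintro q h1 h2 (h3 | ⟨x, h3, h4, h5⟩)
        · have := mem_chainMap.1 h3
          have := hbb q h2
          omega
        · have := mem_chainMap.1 h5
          have := hbb q h2
          have := hle x h3 (by omega)
          omega
  rw [levelSum, Finset.sum_congr rfl fun V hV => if_congr (hiff V hV) rfl rfl]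
  split_ifs with h1 h2
  · simp only [h1, true_or, if_true]
    exact sum_powerset_one_zmod_two hne
  · simp only [h1, false_or]
    refine (sum_powerset_exists_zmod_two hne fun x => a' x = j).trans (if_pos ?_)
    simpa [hj] using h2
  · simp only [h1, false_or]
    refine (sum_powerset_exists_zmod_two hne fun x => a' x = j).trans (if_neg ?_)
    simpa [hj] using h2

/-- Downward induction from level `k - 1`, where the bound required by `levelSum_chainMap` is
trivial. A nonzero sum at level `j` keeps the columns of lower positive level off `j`, which is the
bound needed at `j - 1`. -/
theorem col_levels_of_levelSum_ne_zero (hb : ∀ j < k, ∃ q, b q = j)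
    (hbb : ∀ q, b q < k → b' q = b q) (hi : a' i = 0) (ha : ∀ j < k, ∃ x, a x = j)
    (hak : ∀ x, a x < k) (ha' : ∀ x, a' x < k)
    (h : ∀ j < k, levelSum k (chainMap a' b') i a b j ≠ 0) (x : Fin n) (hx : 1 ≤ a x) :
    a' x = a x := by
  have key (j : ℕ) (hj : 1 ≤ j) (hjk : j < k) (hle : ∀ x, 1 ≤ a x → a x ≤ j → a' x ≤ j) :
      (¬ ∃ x, 1 ≤ a x ∧ a x < j ∧ a' x = j) ∧ ∀ x, a x = j → a' x = j := by
    have := h j hjk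
    rw [levelSum_chainMap hb hbb hi ha hj hjk hle] at this
    split_ifs at this with h1 h2
    · exact absurd rfl this
    · exact ⟨h1, h2⟩
    · exact absurd rfl this
  have hall : ∀ t, t < k → ∀ x, 1 ≤ a x → a x ≤ k - 1 - t → a' x ≤ k - 1 - t := by
    intro t
    induction t with
    | zero =>
      intro _ x _ _
      have := ha' x
      omega
    | succ t ih =>
      intro ht x hx hxt
      have h1 := ih (by omega)
      have h2 := (key (k - 1 - t) (by omega) (by omega) h1).1
      have h3 := h1 x hx (by omega)
      have h4 : a' x ≠ k - 1 - t := fun h4 => h2 ⟨x, hx, by omega, h4⟩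
      omega
  have hxk := hak x
  have h1 := hall (k - 1 - a x) (by omega)
  rw [show k - 1 - (k - 1 - a x) = a x by omega] at h1
  exact (key (a x) hx hxk h1).2 x rfl

theorem levelSum_chainMap_self (hb : ∀ j < k, ∃ q, b q = j) (hi : a i = 0)
    (ha : ∀ j < k, ∃ x, a x = j) {j : ℕ} (hjk : j < k) :
    levelSum k (chainMap a b) i a b j = 1 := by
  classical
  rcases Nat.eq_zero_or_pos j with rfl | hj
  · have hE : EntersExactly k (chainMap a b) i a b 0 ∅ := by
      refine ⟨fun q hq => Or.inl (mem_chainMap.2 (by omega)), ?_⟩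
      rintro q hq - (h | ⟨x, h1, h2, -⟩)
      · have := mem_chainMap.1 h
        omega
      · omega
    rw [levelSum, Finset.filter_false_of_mem (by simp), Finset.powerset_empty,
      Finset.sum_singleton, if_pos hE]
  · rw [levelSum_chainMap hb (fun _ _ => rfl) hi ha hj hjk fun _ _ h => h, if_neg, if_pos]
    · exact fun _ h => h
    · rintro ⟨x, -, h1, h2⟩
      omega

end Triangular

/-! ### The lower bound -/

/-- A prefix table with `k` distinct values forming a chain: the column levels give a surjection
onto `Fin k`; the row levels `j < k` all occur, and rows of level `k` belong to no value. -/
abbrev ChainTable (n k : ℕ) : Type :=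
  {a : Fin n → Fin k // a.Surjective} ×
    {b : Fin n → Fin (k + 1) // ∀ y, y ≠ Fin.last k → ∃ q, b q = y}

theorem card_chainTable (n k : ℕ) :
    Nat.card (ChainTable n k) = k.factorial * Nat.stirlingSecond n k *
      (k.factorial * Nat.stirlingSecond n k +
        (k + 1).factorial * Nat.stirlingSecond n (k + 1)) := by
  have hc : Nat.card {y : Fin (k + 1) // y ≠ Fin.last k} = k := by
    rw [Nat.card_eq_fintype_card, Fintype.card_subtype_compl]
    simp
  rw [Nat.card_prod, card_covering_except, card_surjective_fin, card_surjective_fin,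
    card_surjective_fin, hc, Nat.card_fin, Nat.card_fin]
  ring

namespace ChainTable

variable {n k : ℕ} (t : ChainTable n (k + 1))

def col (x : Fin n) : ℕ := t.1.1 x

def row (q : Fin n) : ℕ := t.2.1 q

theorem col_lt (x : Fin n) : t.col x < k + 1 := (t.1.1 x).2

theorem row_le (q : Fin n) : t.row q ≤ k + 1 := Nat.lt_succ_iff.1 (t.2.1 q).2

theorem exists_col_eq (j : ℕ) (hj : j < k + 1) : ∃ x, t.col x = j := by
  obtain ⟨x, hx⟩ := t.1.2 ⟨j, hj⟩
  exact ⟨x, congrArg Fin.val hx⟩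

theorem exists_row_eq (j : ℕ) (hj : j < k + 1) : ∃ q, t.row q = j := by
  obtain ⟨q, hq⟩ := t.2.2 ⟨j, by omega⟩ (by simp [Fin.ext_iff]; omega)
  exact ⟨q, congrArg Fin.val hq⟩

theorem ext_levels {t t' : ChainTable n (k + 1)} (hc : t.col = t'.col) (hr : t.row = t'.row) :
    t = t' :=
  Prod.ext (Subtype.ext (funext fun x => Fin.ext (congrFun hc x)))
    (Subtype.ext (funext fun q => Fin.ext (congrFun hr q)))

/-- A state at which the chain takes its least value. -/
noncomputable def leastState : Fin n := (t.exists_col_eq 0 k.succ_pos).choose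

theorem col_leastState : t.col t.leastState = 0 := (t.exists_col_eq 0 k.succ_pos).choose_spec

def toPrefixTable : PrefixTable n :=
  ⟨chainMap t.col t.row, fun x => by
      obtain ⟨q, hq⟩ := t.exists_row_eq 0 k.succ_pos
      exact ⟨q, mem_chainMap.2 (by omega)⟩, by
      obtain ⟨x, hx⟩ := t.exists_col_eq 0 k.succ_pos
      exact ⟨x, fun y q hq => mem_chainMap.2 ((mem_chainMap.1 hq).trans (by omega))⟩⟩

noncomputable def word : List (UniversalAlphabet n) :=
  [.leftState t.leastState, .leftTable t.toPrefixTable]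

/-- The coefficient of `t'` in the combination of columns of the acceptance matrix given by `t`. -/
noncomputable def coeff {k' : ℕ} (t' : ChainTable n (k' + 1)) : ZMod 2 :=
  ∏ j : Fin (k + 1), levelSum (k + 1) (chainMap t'.col t'.row) t'.leastState t.col t.row j

theorem coeff_self : t.coeff t = 1 :=
  Finset.prod_eq_one fun j _ =>
    levelSum_chainMap_self t.exists_row_eq t.col_leastState t.exists_col_eq j.2

/-- The secondary key of the triangular order. -/
def weight : ℕ := ∑ x, t.col x + ∑ q, (k + 1 - t.row q)

theorem le_of_coeff_ne_zero {k' : ℕ} {t' : ChainTable n (k' + 1)} (h : t.coeff t' ≠ 0) :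
    k ≤ k' := by
  have h' (j : ℕ) (hj : j < k + 1) := Finset.prod_ne_zero_iff.1 h ⟨j, hj⟩ (Finset.mem_univ _)
  have := (row_levels_of_levelSum_ne_zero t.exists_row_eq t'.col_lt h').1
  omega

/-- All positive column levels and all row levels below the top are forced. What remains free can
only raise columns from 0 or lower rows from the top, and both increase `weight`. -/
theorem eq_or_weight_lt_of_coeff_ne_zero {t' : ChainTable n (k + 1)} (h : t.coeff t' ≠ 0) :
    t = t' ∨ t.weight < t'.weight := by
  have h' (j : ℕ) (hj : j < k + 1) := Finset.prod_ne_zero_iff.1 h ⟨j, hj⟩ (Finset.mem_univ _)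
  have hrow := (row_levels_of_levelSum_ne_zero t.exists_row_eq t'.col_lt h').2 rfl
  have hcol := col_levels_of_levelSum_ne_zero t.exists_row_eq hrow t'.col_leastState
    t.exists_col_eq t.col_lt t'.col_lt h'
  have hc : ∀ x, t.col x ≤ t'.col x := fun x => by
    rcases Nat.eq_zero_or_pos (t.col x) with h0 | h0
    · omega
    · exact (hcol x h0).ge
  have hr : ∀ q, k + 1 - t.row q ≤ k + 1 - t'.row q := fun q => by
    rcases lt_or_ge (t.row q) (k + 1) with h0 | h0
    · rw [hrow q h0]
    · omega
  have h1 := Finset.sum_le_sum fun x (_ : x ∈ Finset.univ) => hc x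
  have h2 := Finset.sum_le_sum fun q (_ : q ∈ Finset.univ) => hr q
  rcases (add_le_add h1 h2).lt_or_eq with hlt | heq
  · exact Or.inr hlt
  · left
    have e1 := (Finset.sum_eq_sum_iff_of_le (s := Finset.univ) fun x _ => hc x).1 (by omega)
    have e2 := (Finset.sum_eq_sum_iff_of_le (s := Finset.univ) fun q _ => hr q).1 (by omega)
    refine ext_levels (funext fun x => e1 x (Finset.mem_univ x)) (funext fun q => ?_)
    have := e2 q (Finset.mem_univ q)
    have := t.row_le q
    have := t'.row_le q
    omega

open Classical in
/-- The coefficients are sums of columns of the acceptance matrix. -/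
theorem sum_mul_coeff_eq_zero {ι : Type*} [Fintype ι] {κ : ι → ℕ}
    (s : ∀ i, ChainTable n (κ i + 1)) (c : ι → ZMod 2)
    (h : ∀ v, ∑ i, c i *
      (if (s i).word ++ v ∈ (universalTwoNFA n).language then 1 else 0) = 0) :
    ∑ i, c i * t.coeff (s i) = 0 := by
  simp_rw [coeff, ← sum_climbsLevels_eq_prod _ _ _ _ t.exists_row_eq, Finset.mul_sum]
  rw [Finset.sum_comm]
  refine Finset.sum_eq_zero fun p _ => ?_
  by_cases hp : ∃ q, k + 1 ≤ raisedRow t.row p q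
  · refine Eq.trans ?_
      (h [.rightTable (SuffixTable.ofLevels (k + 1) _ (raisedCol t.col p) hp)])
    refine Finset.sum_congr rfl fun i _ => ?_
    congr 1
    exact if_congr (mem_language_iff_climbsLevels k.succ_pos (s i).toPrefixTable (s i).leastState
      _ _ (one_le_raisedCol k.succ_pos _ p) hp).symm rfl rfl
  -- If no row reaches the top level, the levels give no suffix table, as no value contains
  -- `Accept`. The top level then cannot be left either, so these terms vanish.
  · refine Finset.sum_eq_zero fun i _ => ?_
    rw [if_neg, mul_zero]
    intro hclimb
    obtain ⟨q, hq, -⟩ := hclimb k k.lt_succ_self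
    exact hp ⟨q, hq⟩

end ChainTable

theorem mainTheorem1 (n : ℕ) {σ : Type*} [Fintype σ]
    (B : NFA (UniversalAlphabet n) σ) (hB : B.IsUnambiguous)
    (hL : B.accepts = (universalTwoNFA n).language) :
    ∑ k ∈ Finset.Icc 1 n,
        (k - 1).factorial * k.factorial * Nat.stirlingSecond n k * Nat.stirlingSecond (n + 1) k
      ≤ Fintype.card σ := by
  classical
  have hcard : Fintype.card ((k : Fin n) × ChainTable n (k + 1)) =
      ∑ k ∈ Finset.Icc 1 n, (k - 1).factorial * k.factorial * Nat.stirlingSecond n k *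
        Nat.stirlingSecond (n + 1) k := by
    rw [sum_factorial_stirling_eq, Fintype.card_sigma]
    refine Finset.sum_congr rfl fun k _ => ?_
    rw [← Nat.card_eq_fintype_card, card_chainTable]
  rw [← hcard]
  refine hB.card_le_card_states (ZMod 2) (fun s => s.2.word) fun c hc => ?_
  rw [hL] at hc
  by_contra! hne
  obtain ⟨s₀, hs₀⟩ := hne
  -- Take the largest key in the support of a supposed dependency: any other chain with nonzero
  -- coefficient in the combination for `s` has a larger key, so only `c s` survives.
  obtain ⟨s, hs, hmax⟩ := Finset.exists_max_image (Finset.univ.filter fun s => c s ≠ 0)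
    (fun s : (k : Fin n) × ChainTable n (k + 1) => toLex ((s.1 : ℕ), s.2.weight))
    ⟨s₀, by simpa using hs₀⟩
  simp only [Finset.mem_filter, Finset.mem_univ, true_and] at hs hmax
  have hsum := s.2.sum_mul_coeff_eq_zero (fun s' : (k : Fin n) × ChainTable n (k + 1) => s'.2) c
    fun v => by convert hc v
  rw [Finset.sum_eq_single s, s.2.coeff_self, mul_one] at hsum
  · exact hs hsum
  · intro s' _ hss'
    by_contra h0
    obtain ⟨hc', hco⟩ := mul_ne_zero_iff.1 h0
    have hle := hmax s' hc'
    rw [Prod.Lex.toLex_le_toLex] at hle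
    obtain ⟨k, t⟩ := s
    obtain ⟨k', t'⟩ := s'
    have hkk : (k : ℕ) ≤ k' := t.le_of_coeff_ne_zero hco
    simp only at hle hco
    have hk : k = k' := Fin.ext (by omega)
    subst hk
    rcases t.eq_or_weight_lt_of_coeff_ne_zero hco with rfl | hlt
    · exact hss' rfl
    · omega
  · simp
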